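/- Let $V_1,V_2$ be real vector spaces with a bilinear pairing $\langle\,,\,\rangle\colon V_1\times V_2\to\mathbb R$, let $S$ be a set, and let $\Pi_1=\{\alpha_s\mid s\in S\}\subseteq V_1$ and $\Pi_2=\{\beta_s\mid s\in S\}\subseteq V_2$ both be in bijection with $S$. For a subset $A$ of a real vector space let $\mathrm{PLC}(A)$ be the set of all finite sums $\sum_{a\in A}c_a a$ with all $c_a\ge 0$ and some $c_a>0$. Suppose that for all $s,t\in S$: (D1) $\langle\alpha_s,\beta_s\rangle=1$; (D2) $0\notin\mathrm{PLC}(\Pi_1)$, $0\notin\mathrm{PLC}(\Pi_2)$, $\alpha_s\notin\mathrm{PLC}(\Pi_1\setminus\{\alpha_s\})$ and $\beta_s\notin\mathrm{PLC}(\Pi_2\setminus\{\beta_s\})$; (D3) $\langle\alpha_s,\beta_t\rangle\le 0$ and $\langle\alpha_t,\beta_s\rangle\le 0$ if $s\ne t$; (D4) $\langle\alpha_s,\beta_t\rangle=0$ if and only if $\langle\alpha_t,\beta_s\rangle=0$; (D5) either $\langle\alpha_s,\beta_t\rangle\langle\alpha_t,\beta_s\rangle=\cos^2(\pi/m_{st})$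 for some integer $m_{st}\ge 2$, or $\langle\alpha_s,\beta_t\rangle\langle\alpha_t,\beta_s\rangle\ge 1$ (in which case, for $s \neq t$, put $m_{st}=\infty$). Let $(W,R)$, $R=\{r_s\mid s\in S\}$, be the Coxeter system in which, for $s\ne t$, $r_sr_t$ has order $m_{st}$, and let $\ell$ be its length function. Let $W$ act linearly on $V_1$ and $V_2$ by $r_s x=x-2\langle x,\beta_s\rangle\alpha_s$ and $r_s y=y-2\langle\alpha_s,y\rangle\beta_s$. For $i\in\{1,2\}$ put $\Phi_i=W\Pi_i$, $\Phi_i^+=\Phi_i\cap\mathrm{PLC}(\Pi_i)$ and $\Phi_i^-=-\Phi_i^+$. For a root $x\in\Phi_1$ (respectively $x\in\Phi_2$) let $r_x=u r_s u^{-1}$ be the reflection corresponding to $x$, where $u\in W$ and $s\in S$ are such that $x=u\alpha_s$ (respectively $x=u\beta_s$); the statement holds for every such choice of $u$ and $s$. Then for each $i\in\{1,2\}$, every $w\in W$ and every $x\in\Phi_i^+$: if $\ell(wr_x)>\ell(w)$ then $wx\in\Phi_i^+$, and if $\ell(wr_x)<\ell(w)$ then $wx\in\Phi_i^-$. -/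

import Mathlib

/-- The positive linear cone of a subset `A` of a real vector space: all finite linear
combinations of elements of `A` with nonnegative coefficients, at least one of which is positive. -/
def PLC {V : Type*} [AddCommGroup V] [Module ℝ V] (A : Set V) : Set V :=
  {v | ∃ c : V →₀ ℝ, (↑c.support ⊆ A) ∧ (∀ a, 0 ≤ c a) ∧ (∃ a ∈ A, 0 < c a) ∧
    v = c.sum fun a r => r • a}

/-- A datum `(S, V₁, V₂, Π₁, Π₂, ⟨ , ⟩)` consisting of two real vector spaces, a bilinear pairing
(not assumed to be nondegenerate) and two families `Π₁ = {α s}`, `Π₂ = {β s}` (not assumed to be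
linearly independent), each in bijection with `S`, subject to the conditions (D1) to (D5). -/
structure CoxeterDatum (S V₁ V₂ : Type*) [AddCommGroup V₁] [Module ℝ V₁]
    [AddCommGroup V₂] [Module ℝ V₂] where
  /-- the bilinear pairing `⟨ , ⟩ : V₁ × V₂ → ℝ` -/
  pairing : V₁ →ₗ[ℝ] V₂ →ₗ[ℝ] ℝ
  /-- the simple roots in `V₁` -/
  α : S → V₁
  /-- the simple roots in `V₂` -/
  β : S → V₂
  α_injective : Function.Injective α
  β_injective : Function.Injective β
  D1 : ∀ s, pairing (α s) (β s) = 1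
  D2_i₁ : (0 : V₁) ∉ PLC (Set.range α)
  D2_i₂ : (0 : V₂) ∉ PLC (Set.range β)
  D2_ii₁ : ∀ s, α s ∉ PLC (Set.range α \ {α s})
  D2_ii₂ : ∀ s, β s ∉ PLC (Set.range β \ {β s})
  D3 : ∀ s t, s ≠ t → pairing (α s) (β t) ≤ 0 ∧ pairing (α t) (β s) ≤ 0
  D4 : ∀ s t, pairing (α s) (β t) = 0 ↔ pairing (α t) (β s) = 0
  D5 : ∀ s t,
    (∃ m : ℕ, 2 ≤ m ∧ pairing (α s) (β t) * pairing (α t) (β s) = Real.cos (Real.pi / m) ^ 2) ∨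
    1 ≤ pairing (α s) (β t) * pairing (α t) (β s)

namespace CoxeterDatum

variable {S V₁ V₂ : Type*} [AddCommGroup V₁] [Module ℝ V₁] [AddCommGroup V₂] [Module ℝ V₂]
  (D : CoxeterDatum S V₁ V₂)

/-- The reflection `x ↦ x - 2⟨x, β s⟩ α s` of `V₁`. -/
noncomputable def ρ₁ (s : S) : V₁ ≃ₗ[ℝ] V₁ :=
  Module.reflection (x := D.α s) (f := (2 : ℝ) • D.pairing.flip (D.β s)) (by simp [D.D1 s])

/-- The reflection `y ↦ y - 2⟨α s, y⟩ β s` of `V₂`. -/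
noncomputable def ρ₂ (s : S) : V₂ ≃ₗ[ℝ] V₂ :=
  Module.reflection (x := D.β s) (f := (2 : ℝ) • D.pairing (D.α s)) (by simp [D.D1 s])

theorem ρ₁_apply (s : S) (x : V₁) :
    D.ρ₁ s x = x - (2 * D.pairing x (D.β s)) • D.α s := by
  simp [ρ₁, Module.reflection_apply]

theorem ρ₂_apply (s : S) (y : V₂) :
    D.ρ₂ s y = y - (2 * D.pairing (D.α s) y) • D.β s := by
  simp [ρ₂, Module.reflection_apply]

/-- The root system `Φ₁ = W₁ Π₁`, where `W₁` is the group generated by the `ρ₁ s`. -/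
def roots₁ : Set V₁ :=
  {x | ∃ g ∈ Subgroup.closure (Set.range D.ρ₁), ∃ s, x = g (D.α s)}

/-- The root system `Φ₂ = W₂ Π₂`, where `W₂` is the group generated by the `ρ₂ s`. -/
def roots₂ : Set V₂ :=
  {y | ∃ g ∈ Subgroup.closure (Set.range D.ρ₂), ∃ s, y = g (D.β s)}

/-- The positive roots `Φ₁⁺ = Φ₁ ∩ PLC(Π₁)`. -/
def posRoots₁ : Set V₁ := D.roots₁ ∩ PLC (Set.range D.α)

/-- The positive roots `Φ₂⁺ = Φ₂ ∩ PLC(Π₂)`. -/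
def posRoots₂ : Set V₂ := D.roots₂ ∩ PLC (Set.range D.β)

/-- The negative roots `Φ₁⁻ = -Φ₁⁺`. -/
def negRoots₁ : Set V₁ := {x | -x ∈ D.posRoots₁}

/-- The negative roots `Φ₂⁻ = -Φ₂⁺`. -/
def negRoots₂ : Set V₂ := {y | -y ∈ D.posRoots₂}

open Classical in
/-- The entry `m_{st}` for `s, t` in `S`: it is `1` if `s = t`; if `s ≠ t` it is the integer
`m ≥ 2` with `⟨α s, β t⟩⟨α t, β s⟩ = cos² (π / m)` if there is one, and otherwise it is `0`,
which is Mathlib's encoding of `∞` in a Coxeter matrix. -/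
noncomputable def order (s t : S) : ℕ :=
  if s = t then 1
  else if h : ∃ m : ℕ, 2 ≤ m ∧
      D.pairing (D.α s) (D.β t) * D.pairing (D.α t) (D.β s) = Real.cos (Real.pi / m) ^ 2
    then Nat.find h
  else 0

theorem order_spec {s t : S} (hst : s ≠ t) (h0 : D.order s t ≠ 0) :
    2 ≤ D.order s t ∧ D.pairing (D.α s) (D.β t) * D.pairing (D.α t) (D.β s) =
      Real.cos (Real.pi / D.order s t) ^ 2 := by
  classical
  unfold order at *
  rw [if_neg hst] at *
  split_ifs at h0 ⊢ with h
  · exact Nat.find_spec h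
  · exact absurd rfl h0

/-- The Coxeter matrix of the abstract Coxeter system corresponding to the datum. -/
noncomputable def coxeterMatrix : CoxeterMatrix S where
  M := Matrix.of D.order
  isSymm := by
    ext s t
    change D.order t s = D.order s t
    by_cases hst : s = t
    · rw [hst]
    have h : D.pairing (D.α t) (D.β s) * D.pairing (D.α s) (D.β t) =
      D.pairing (D.α s) (D.β t) * D.pairing (D.α t) (D.β s) := mul_comm _ _
    unfold order
    rw [if_neg hst, if_neg (Ne.symm hst)]
    generalize D.pairing (D.α t) (D.β s) * D.pairing (D.α s) (D.β t) = a at h ⊢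
    subst h
    rfl
  diagonal s := by simp [order]
  off_diagonal s t hst h1 := by
    have h := D.order_spec (s := s) (t := t) hst (by rw [Matrix.of_apply] at h1; omega)
    rw [Matrix.of_apply] at h1
    omega

/-- If `f y * g x = 4 cos² (π / m)` for some `m ≥ 2`, and if `f y`, `g x` vanish together, then the
product of the reflections `z ↦ z - f z • x` and `z ↦ z - g z • y` has `m`-th power `1`. -/
theorem reflection_mul_reflection_pow_eq_one {V : Type*} [AddCommGroup V] [Module ℝ V]
    {x y : V} {f g : Module.Dual ℝ V} (hf : f x = 2) (hg : g y = 2) (h0 : f y = 0 ↔ g x = 0)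
    {m : ℕ} (hm : 2 ≤ m) (h : f y * g x = 4 * Real.cos (Real.pi / m) ^ 2) :
    (Module.reflection hf * Module.reflection hg) ^ m = 1 := by
  ext z
  rw [Module.reflection_mul_reflection_pow_apply hf hg m z (2 * Real.cos (2 * Real.pi / m))
    (by rw [h, mul_div_assoc, Real.cos_two_mul]; ring)]
  rw [LinearEquiv.coe_one, id]
  have hm0 : (m : ℝ) ≠ 0 := by positivity
  rcases hm.eq_or_lt with rfl | hm3
  · have hfg : f y * g x = 0 := by rw [h]; simp
    have hfy : f y = 0 := by
      rcases mul_eq_zero.mp hfg with h1 | h1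
      · exact h1
      · exact h0.mpr h1
    have hgx : g x = 0 := h0.mp hfy
    norm_num [hfy, hgx]
    module
  · have hsin : Real.sin (2 * Real.pi / m) ≠ 0 := by
      apply ne_of_gt
      apply Real.sin_pos_of_pos_of_lt_pi
      · positivity
      · rw [div_lt_iff₀ (by positivity)]
        have : (3 : ℝ) ≤ m := by exact_mod_cast hm3
        nlinarith [Real.pi_pos]
    have key : ∀ n : ℤ, (Polynomial.Chebyshev.S ℝ n).eval (2 * Real.cos (2 * Real.pi / m)) =
        Real.sin ((n + 1) * (2 * Real.pi / m)) / Real.sin (2 * Real.pi / m) := by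
      intro n
      rw [eq_div_iff hsin]
      exact Polynomial.Chebyshev.S_two_mul_real_cos _ n
    obtain ⟨k, hk⟩ := Nat.even_or_odd' m
    rcases hk with hk | hk
    · have e1 : ((m : ℤ) - 2) / 2 = (k : ℤ) - 1 := by omega
      have e2 : ((m : ℤ) - 1) / 2 = (k : ℤ) - 1 := by omega
      have hz : (Polynomial.Chebyshev.S ℝ ((k : ℤ) - 1)).eval
          (2 * Real.cos (2 * Real.pi / m)) = 0 := by
        rw [key]
        have : (((k : ℤ) - 1 : ℤ) + 1 : ℝ) * (2 * Real.pi / m) = Real.pi := by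
          have : (m : ℝ) = 2 * k := by exact_mod_cast hk
          push_cast
          field_simp
          rw [this]; ring
        rw [this]; simp
      rw [e1, e2, hz]
      simp
    · have e1 : ((m : ℤ) - 2) / 2 = (k : ℤ) - 1 := by omega
      have e2 : ((m : ℤ) - 1) / 2 = (k : ℤ) := by omega
      have e3 : ((m : ℤ) - 3) / 2 = (k : ℤ) - 1 := by omega
      have e4 : (m : ℤ) / 2 = (k : ℤ) := by omega
      have hz : (Polynomial.Chebyshev.S ℝ (k : ℤ)).eval (2 * Real.cos (2 * Real.pi / m)) +
          (Polynomial.Chebyshev.S ℝ ((k : ℤ) - 1)).eval (2 * Real.cos (2 * Real.pi / m)) = 0 := by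
        rw [key, key, ← add_div]
        have : ((k : ℤ) + 1 : ℝ) * (2 * Real.pi / m) =
            2 * Real.pi - (((k : ℤ) - 1 : ℤ) + 1 : ℝ) * (2 * Real.pi / m) := by
          have : (m : ℝ) = 2 * k + 1 := by exact_mod_cast hk
          push_cast
          field_simp
          rw [this]; ring
        rw [this, Real.sin_two_pi_sub]; simp
      rw [e1, e2, e3, e4, hz]
      simp

theorem isLiftable₁ : D.coxeterMatrix.IsLiftable D.ρ₁ := by
  intro s t
  change (D.ρ₁ s * D.ρ₁ t) ^ D.order s t = 1
  by_cases hst : s = t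
  · subst hst
    ext z
    simp only [order, if_true, pow_one]
    exact Module.involutive_reflection _ z
  by_cases h0 : D.order s t = 0
  · rw [h0, pow_zero]
  obtain ⟨h2, h⟩ := D.order_spec hst h0
  apply reflection_mul_reflection_pow_eq_one _ _ _ h2
  · simp only [LinearMap.smul_apply, LinearMap.flip_apply, smul_eq_mul]
    linear_combination 4 * h
  · simpa using D.D4 t s

theorem isLiftable₂ : D.coxeterMatrix.IsLiftable D.ρ₂ := by
  intro s t
  change (D.ρ₂ s * D.ρ₂ t) ^ D.order s t = 1
  by_cases hst : s = t
  · subst hst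
    ext z
    simp only [order, if_true, pow_one]
    exact Module.involutive_reflection _ z
  by_cases h0 : D.order s t = 0
  · rw [h0, pow_zero]
  obtain ⟨h2, h⟩ := D.order_spec hst h0
  apply reflection_mul_reflection_pow_eq_one _ _ _ h2
  · simp only [LinearMap.smul_apply, smul_eq_mul]
    linear_combination 4 * h
  · simpa using D.D4 s t

variable {W : Type*} [Group W] (cs : CoxeterSystem D.coxeterMatrix W)

/-- The action of the abstract Coxeter group `W` on `V₁`: the homomorphism `W → GL(V₁)` that takes
the Coxeter generator `r s` to `ρ₁ s`. -/
noncomputable def action₁ : W →* (V₁ ≃ₗ[ℝ] V₁) := cs.lift ⟨D.ρ₁, D.isLiftable₁⟩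

/-- The action of the abstract Coxeter group `W` on `V₂`: the homomorphism `W → GL(V₂)` that takes
the Coxeter generator `r s` to `ρ₂ s`. -/
noncomputable def action₂ : W →* (V₂ ≃ₗ[ℝ] V₂) := cs.lift ⟨D.ρ₂, D.isLiftable₂⟩

/-- `r` is the reflection `r_x` in `W` corresponding to the root `x` in `Φ₁`, that is,
`r = u r_s u⁻¹` for some `u` in `W` and `s` in `S` with `x = u α_s`. -/
def IsReflectionOf₁ (r : W) (x : V₁) : Prop :=
  ∃ (u : W) (s : S), x = D.action₁ cs u (D.α s) ∧ r = u * cs.simple s * u⁻¹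

/-- `r` is the reflection `r_y` in `W` corresponding to the root `y` in `Φ₂`, that is,
`r = u r_s u⁻¹` for some `u` in `W` and `s` in `S` with `y = u β_s`. -/
def IsReflectionOf₂ (r : W) (y : V₂) : Prop :=
  ∃ (u : W) (s : S), y = D.action₂ cs u (D.β s) ∧ r = u * cs.simple s * u⁻¹

/-- Every root in `Φ₁` has a corresponding reflection. -/
theorem exists_isReflectionOf₁ {x : V₁} (h : x ∈ D.roots₁) :
    ∃ r, D.IsReflectionOf₁ cs r x := by
  obtain ⟨g, hg, s, rfl⟩ := h
  have hle : Subgroup.closure (Set.range D.ρ₁) ≤ (D.action₁ cs).range := by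
    rw [Subgroup.closure_le]
    rintro _ ⟨t, rfl⟩
    exact ⟨cs.simple t, cs.lift_apply_simple D.isLiftable₁ t⟩
  obtain ⟨u, rfl⟩ := hle hg
  exact ⟨_, u, s, rfl, rfl⟩

/-- Every root in `Φ₂` has a corresponding reflection. -/
theorem exists_isReflectionOf₂ {y : V₂} (h : y ∈ D.roots₂) :
    ∃ r, D.IsReflectionOf₂ cs r y := by
  obtain ⟨g, hg, s, rfl⟩ := h
  have hle : Subgroup.closure (Set.range D.ρ₂) ≤ (D.action₂ cs).range := by
    rw [Subgroup.closure_le]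
    rintro _ ⟨t, rfl⟩
    exact ⟨cs.simple t, cs.lift_apply_simple D.isLiftable₂ t⟩
  obtain ⟨u, rfl⟩ := hle hg
  exact ⟨_, u, s, rfl, rfl⟩

end CoxeterDatum

/-! The two sides of the datum play symmetric roles, so the argument is run once, for a `RootRep`.
Its simple roots α_s span a pointed cone C in which each spans an extremal ray; this replaces linear
independence.

Simple roots come first (`act_root_mem_cone`): if w r_s is longer than w, then w α_s ∈ C. By
induction on length, write w = v d with d in ⟨r_s, r_t⟩ and v having neither s nor t as a right
descent. Then d α_s is a combination of α_s and α_t whose coefficients are nonnegative Chebyshev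
values, and induction applies to v.

For the reflection r of a positive root x (`act_reflection_mem_cone`), strip a left descent: w = r_t
v with v x ∈ C by induction. If w x left C, then -w x ∈ C, and extremality would make v x a multiple
of α_t. The factor need not be 1, as the pairing is not symmetric. Still v r v⁻¹ = r_t
(`conj_simple_eq`): the product of these reflections acts as a transvection along α_t, and signs of
roots force it to be trivial. Hence w r = v is shorter than w, a contradiction. -/

open scoped NNReal

/-! ### Pointed cones and extremal rays. -/

section Cone

variable {V : Type*} [AddCommGroup V] [Module ℝ V]

theorem smul_mem_span_nnreal {A : Set V} {v : V} {r : ℝ} (hr : 0 ≤ r)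
    (hv : v ∈ Submodule.span ℝ≥0 A) : r • v ∈ Submodule.span ℝ≥0 A :=
  Submodule.smul_mem _ (⟨r, hr⟩ : ℝ≥0) hv

theorem mem_span_nnreal_iff {A : Set V} {v : V} :
    v ∈ Submodule.span ℝ≥0 A ↔ ∃ c : V →₀ ℝ, (↑c.support ⊆ A) ∧ (∀ a, 0 ≤ c a) ∧
      v = c.sum fun a r => r • a := by
  constructor
  · intro h
    obtain ⟨c, hc, rfl⟩ := Submodule.mem_span_set.mp h
    refine ⟨c.mapRange NNReal.toReal NNReal.coe_zero, ?_, fun a => by simp, ?_⟩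
    · exact fun a ha => hc (Finsupp.support_mapRange ha)
    · rw [Finsupp.sum_mapRange_index (by simp)]
      rfl
  · rintro ⟨c, hc, h0, rfl⟩
    exact Submodule.sum_mem _ fun a ha =>
      smul_mem_span_nnreal (h0 a) (Submodule.subset_span (hc ha))

theorem mem_span_of_mem_PLC {A : Set V} {v : V} (h : v ∈ PLC A) :
    v ∈ Submodule.span ℝ≥0 A := by
  obtain ⟨c, hc, h0, -, rfl⟩ := h
  exact mem_span_nnreal_iff.mpr ⟨c, hc, h0, rfl⟩

theorem mem_PLC_of_mem_span {A : Set V} {v : V} (h : v ∈ Submodule.span ℝ≥0 A) (hv : v ≠ 0) :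
    v ∈ PLC A := by
  obtain ⟨c, hc, h0, rfl⟩ := mem_span_nnreal_iff.mp h
  have hc0 : c ≠ 0 := by
    rintro rfl
    simp at hv
  obtain ⟨a, ha⟩ := Finsupp.ne_iff.mp hc0
  exact ⟨c, hc, h0, ⟨a, hc (by simpa using ha), lt_of_le_of_ne (h0 a) (Ne.symm ha)⟩, rfl⟩

theorem PLC_add_mem {A : Set V} {v w : V} (hv : v ∈ PLC A)
    (hw : w ∈ Submodule.span ℝ≥0 A) : v + w ∈ PLC A := by
  classical
  obtain ⟨c, hc, h0, ⟨a, ha, hpos⟩, rfl⟩ := hv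
  obtain ⟨d, hd, hd0, rfl⟩ := mem_span_nnreal_iff.mp hw
  refine ⟨c + d, fun b hb => ?_, fun b => add_nonneg (h0 b) (hd0 b),
    ⟨a, ha, add_pos_of_pos_of_nonneg hpos (hd0 a)⟩, ?_⟩
  · rcases Finset.mem_union.mp (Finsupp.support_add hb) with h | h
    exacts [hc h, hd h]
  · rw [Finsupp.sum_add_index (by simp) (fun _ _ _ _ => add_smul _ _ _)]

theorem PLC_mono {A B : Set V} (h : A ⊆ B) : PLC A ⊆ PLC B := by
  rintro v ⟨c, hc, h0, ⟨a, ha, hpos⟩, hv⟩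
  exact ⟨c, hc.trans h, h0, ⟨a, h ha, hpos⟩, hv⟩

/-- The cone spanned by `A` is pointed when `0 ∉ PLC A`. -/
theorem eq_zero_of_mem_span_of_neg_mem_span {A : Set V} (hA : (0 : V) ∉ PLC A) {v : V}
    (hv : v ∈ Submodule.span ℝ≥0 A) (hv' : -v ∈ Submodule.span ℝ≥0 A) : v = 0 := by
  by_contra h
  exact hA (by simpa using PLC_add_mem (mem_PLC_of_mem_span hv h) hv')

/-- If `a ∈ A` is not in the cone of the remaining elements, it spans an extremal ray of the cone
of `A`. -/
theorem exists_smul_eq_of_add_eq_smul {A : Set V} (hA : (0 : V) ∉ PLC A) {a : V} (ha : a ∈ A)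
    (ha0 : a ≠ 0) (ha' : a ∉ PLC (A \ {a})) {v w : V} (hv : v ∈ Submodule.span ℝ≥0 A)
    (hw : w ∈ Submodule.span ℝ≥0 A) {k : ℝ} (h : v + w = k • a) :
    ∃ p : ℝ, 0 ≤ p ∧ v = p • a := by
  have hins : A = insert a (A \ {a}) := by simp [Set.insert_eq_of_mem ha]
  have hA' : (0 : V) ∉ PLC (A \ {a}) := fun h => hA (PLC_mono Set.sdiff_subset h)
  rw [hins] at hv hw
  obtain ⟨p, v', hv', rfl⟩ := Submodule.mem_span_insert.mp hv
  obtain ⟨q, w', hw', rfl⟩ := Submodule.mem_span_insert.mp hw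
  have key : (k - p - q) • a = v' + w' := by
    have h' : (p : ℝ) • a + v' + ((q : ℝ) • a + w') = k • a := h
    rw [sub_smul, sub_smul, ← h']
    module
  have hvw : v' + w' ∈ Submodule.span ℝ≥0 (A \ {a}) := add_mem hv' hw'
  -- If k - p - q > 0, dividing by it puts a in the cone of the other elements; otherwise the
  -- relation is a nontrivial nonnegative combination equal to 0.
  have hzero : v' + w' = 0 := by
    by_contra hne
    rcases lt_or_ge 0 (k - p - q) with hk | hk
    · refine ha' (mem_PLC_of_mem_span ?_ ha0)
      have := smul_mem_span_nnreal (inv_nonneg.mpr hk.le) hvw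
      rwa [← key, inv_smul_smul₀ hk.ne'] at this
    · have hmem : v' + w' ∈ PLC A := PLC_mono Set.sdiff_subset (mem_PLC_of_mem_span hvw hne)
      have h0 := PLC_add_mem hmem
        (smul_mem_span_nnreal (neg_nonneg.mpr hk) (Submodule.subset_span ha))
      rw [← key, ← add_smul, add_neg_cancel, zero_smul] at h0
      exact hA h0
  have hv0 : v' = 0 := eq_zero_of_mem_span_of_neg_mem_span hA' hv'
    (by rwa [neg_eq_of_add_eq_zero_right hzero])
  exact ⟨p, p.2, by rw [hv0, add_zero]; rfl⟩

end Cone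

/-! ### Signs of Chebyshev polynomials of the second kind. -/

section Chebyshev

open Polynomial

/-- For c ≥ 1 the recursion makes U_n(c) nondecreasing in n, starting from U_{-1} = 0; the induction
carries this monotonicity along. -/
theorem chebyshev_U_eval_nonneg_of_one_le {c : ℝ} (hc : 1 ≤ c) (n : ℕ) :
    0 ≤ (Chebyshev.U ℝ ((n : ℤ) - 1)).eval c := by
  suffices h : 0 ≤ (Chebyshev.U ℝ ((n : ℤ) - 1)).eval c ∧
      (Chebyshev.U ℝ ((n : ℤ) - 1)).eval c ≤ (Chebyshev.U ℝ (n : ℤ)).eval c from h.1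
  induction n with
  | zero => simp
  | succ n ih =>
    have e : (Chebyshev.U ℝ ((n + 1 : ℕ) : ℤ)).eval c =
        2 * c * (Chebyshev.U ℝ (n : ℤ)).eval c - (Chebyshev.U ℝ ((n : ℤ) - 1)).eval c := by
      rw [Nat.cast_add_one, Chebyshev.U_add_one]
      simp
    rw [e]
    push_cast
    rw [add_sub_cancel_right]
    refine ⟨ih.1.trans ih.2, ?_⟩
    nlinarith [ih.1, ih.2]

/-- With θ = π/m, U_{n-1}(cos θ) = sin(nθ)/sin θ, and nθ ≤ π. -/
theorem chebyshev_U_eval_cos_pi_div_nonneg {m n : ℕ} (hm : 2 ≤ m) (hn : n ≤ m) :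
    0 ≤ (Chebyshev.U ℝ ((n : ℤ) - 1)).eval (Real.cos (Real.pi / m)) := by
  have hm0 : (0 : ℝ) < m := by positivity
  have hm2 : (2 : ℝ) ≤ m := by exact_mod_cast hm
  have hnm : (n : ℝ) ≤ m := by exact_mod_cast hn
  have hsin : 0 < Real.sin (Real.pi / m) := by
    apply Real.sin_pos_of_pos_of_lt_pi (by positivity)
    rw [div_lt_iff₀ hm0]
    nlinarith [Real.pi_pos]
  have h := Chebyshev.U_real_cos (Real.pi / m) ((n : ℤ) - 1)
  have hpos : 0 ≤ Real.sin ((((n : ℤ) - 1 : ℤ) + 1 : ℝ) * (Real.pi / m)) := by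
    push_cast
    rw [sub_add_cancel]
    apply Real.sin_nonneg_of_nonneg_of_le_pi (by positivity)
    rw [mul_div_assoc', div_le_iff₀ hm0]
    nlinarith [Real.pi_pos]
  rw [← h] at hpos
  exact nonneg_of_mul_nonneg_left hpos hsin

end Chebyshev

/-! ### Root representations and their rank two computations. -/

/-- A linear action of a Coxeter group in which the simple reflections act as reflections in
`root s` along `coroot s`, with the roots spanning a pointed cone with extremal rays `root s`. -/
structure CoxeterSystem.RootRep {S W : Type*} [Group W] {M : CoxeterMatrix S}
    (cs : CoxeterSystem M W) (V : Type*) [AddCommGroup V] [Module ℝ V] where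
  act : W →* (V ≃ₗ[ℝ] V)
  root : S → V
  coroot : S → V →ₗ[ℝ] ℝ
  act_simple : ∀ s x, act (cs.simple s) x = x - coroot s x • root s
  coroot_self : ∀ s, coroot s (root s) = 2
  coroot_nonpos : ∀ s t, s ≠ t → coroot s (root t) ≤ 0
  coroot_eq_zero : ∀ s t, coroot s (root t) = 0 → coroot t (root s) = 0
  coroot_mul_of_ne_zero : ∀ s t, s ≠ t → M s t ≠ 0 →
    coroot s (root t) * coroot t (root s) = 4 * Real.cos (Real.pi / M s t) ^ 2
  coroot_mul_of_eq_zero : ∀ s t, s ≠ t → M s t = 0 →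
    4 ≤ coroot s (root t) * coroot t (root s)
  root_injective : Function.Injective root
  zero_notMem : (0 : V) ∉ PLC (Set.range root)
  root_notMem : ∀ s, root s ∉ PLC (Set.range root \ {root s})

namespace CoxeterSystem.RootRep

open CoxeterSystem

variable {S W V : Type*} [Group W] {M : CoxeterMatrix S} {cs : CoxeterSystem M W}
  [AddCommGroup V] [Module ℝ V] (ρ : cs.RootRep V)

theorem root_ne_zero (s : S) : ρ.root s ≠ 0 := by
  intro h
  simpa [h] using ρ.coroot_self s

/-- The convex cone spanned by the simple roots. -/
abbrev cone : Submodule ℝ≥0 V := Submodule.span ℝ≥0 (Set.range ρ.root)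

theorem root_mem_cone (s : S) : ρ.root s ∈ ρ.cone :=
  Submodule.subset_span ⟨s, rfl⟩

theorem act_simple_root (s : S) : ρ.act (cs.simple s) (ρ.root s) = -ρ.root s := by
  rw [ρ.act_simple, ρ.coroot_self]
  module

theorem act_mul_apply (u w : W) (x : V) : ρ.act (u * w) x = ρ.act u (ρ.act w x) := by
  rw [map_mul]
  rfl

theorem act_mul_simple_root (w : W) (s : S) :
    ρ.act (w * cs.simple s) (ρ.root s) = -ρ.act w (ρ.root s) := by
  rw [act_mul_apply, act_simple_root, map_neg]

theorem act_root_ne_zero (w : W) (s : S) : ρ.act w (ρ.root s) ≠ 0 :=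
  (LinearEquiv.map_ne_zero_iff _).mpr (ρ.root_ne_zero s)

theorem eq_zero_of_mem_cone {x : V} (h : x ∈ ρ.cone) (h' : -x ∈ ρ.cone) : x = 0 :=
  eq_zero_of_mem_span_of_neg_mem_span ρ.zero_notMem h h'

theorem exists_smul_root {v w : V} {t : S} (hv : v ∈ ρ.cone) (hw : w ∈ ρ.cone) {k : ℝ}
    (h : v + w = k • ρ.root t) : ∃ p : ℝ, 0 ≤ p ∧ v = p • ρ.root t :=
  exists_smul_eq_of_add_eq_smul ρ.zero_notMem ⟨t, rfl⟩ (ρ.root_ne_zero t) (ρ.root_notMem t)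
    hv hw h

/-- The action of the dihedral group generated by two simple reflections on a simple root. -/
theorem act_alternatingWord_root {s t : S} {a c : ℝ}
    (hst : ρ.coroot t (ρ.root s) = -(2 * (a * c))) (hts : a * ρ.coroot s (ρ.root t) = -(2 * c))
    (k : ℕ) :
    ρ.act (cs.wordProd (alternatingWord s t k)) (ρ.root s) =
      if Even k then
        ((Polynomial.Chebyshev.U ℝ (k : ℤ)).eval c) • ρ.root s +
          (a * (Polynomial.Chebyshev.U ℝ ((k : ℤ) - 1)).eval c) • ρ.root t
      else
        ((Polynomial.Chebyshev.U ℝ ((k : ℤ) - 1)).eval c) • ρ.root s +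
          (a * (Polynomial.Chebyshev.U ℝ (k : ℤ)).eval c) • ρ.root t := by
  induction k with
  | zero => simp [alternatingWord]
  | succ k ih =>
    have e : (Polynomial.Chebyshev.U ℝ ((k + 1 : ℕ) : ℤ)).eval c =
        2 * c * (Polynomial.Chebyshev.U ℝ (k : ℤ)).eval c -
          (Polynomial.Chebyshev.U ℝ ((k : ℤ) - 1)).eval c := by
      rw [Nat.cast_add_one, Polynomial.Chebyshev.U_add_one]
      simp
    have e' : ((k + 1 : ℕ) : ℤ) - 1 = k := by push_cast; ring
    rw [alternatingWord_succ', wordProd_cons, act_mul_apply, ih, e, e']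
    generalize (Polynomial.Chebyshev.U ℝ (k : ℤ)).eval c = y
    generalize (Polynomial.Chebyshev.U ℝ ((k : ℤ) - 1)).eval c = z
    by_cases hk : Even k
    · have hk' : ¬ Even (k + 1) := by simp [hk, parity_simps]
      rw [if_pos hk, if_pos hk, if_neg hk', ρ.act_simple, map_add, map_smul, map_smul, hst,
        ρ.coroot_self, smul_eq_mul, smul_eq_mul]
      module
    · have hk' : Even (k + 1) := by simp [hk, parity_simps]
      rw [if_neg hk, if_neg hk, if_pos hk', ρ.act_simple, map_add, map_smul, map_smul,
        ρ.coroot_self, smul_eq_mul, smul_eq_mul,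
        show a * y * ρ.coroot s (ρ.root t) = y * (a * ρ.coroot s (ρ.root t)) by ring, hts]
      module

/-- Replacing α_t by a α_t symmetrizes the rank two Cartan matrix, with off-diagonal entries -2c.
Here c is cos(π/m), or at least 1 when m = ∞ (encoded by `M s t = 0`). -/
theorem exists_scaling {s t : S} (hst : s ≠ t) :
    ∃ a c : ℝ, 0 ≤ a ∧ ρ.coroot t (ρ.root s) = -(2 * (a * c)) ∧
      a * ρ.coroot s (ρ.root t) = -(2 * c) ∧
      ∀ n : ℕ, (M s t ≠ 0 → n ≤ M s t) →
        0 ≤ (Polynomial.Chebyshev.U ℝ ((n : ℤ) - 1)).eval c := by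
  have h1 := ρ.coroot_nonpos s t hst
  have h2 := ρ.coroot_nonpos t s hst.symm
  have h3 := ρ.coroot_eq_zero s t
  have h4 := ρ.coroot_eq_zero t s
  obtain ⟨c, hc0, hc, hU⟩ : ∃ c : ℝ, 0 ≤ c ∧
      ρ.coroot s (ρ.root t) * ρ.coroot t (ρ.root s) = 4 * c ^ 2 ∧
      ∀ n : ℕ, (M s t ≠ 0 → n ≤ M s t) →
        0 ≤ (Polynomial.Chebyshev.U ℝ ((n : ℤ) - 1)).eval c := by
    by_cases hM : M s t = 0
    · have h := ρ.coroot_mul_of_eq_zero s t hst hM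
      refine ⟨√(ρ.coroot s (ρ.root t) * ρ.coroot t (ρ.root s) / 4), Real.sqrt_nonneg _, ?_,
        fun n _ => chebyshev_U_eval_nonneg_of_one_le ?_ n⟩
      · rw [Real.sq_sqrt (by linarith)]
        ring
      · rw [Real.one_le_sqrt]
        linarith
    · have hM2 : 2 ≤ M s t := by
        have := M.off_diagonal s t hst
        omega
      have hM2' : (2 : ℝ) ≤ M s t := by exact_mod_cast hM2
      refine ⟨_, ?_, ρ.coroot_mul_of_ne_zero s t hst hM,
        fun n hn => chebyshev_U_eval_cos_pi_div_nonneg hM2 (hn hM)⟩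
      apply Real.cos_nonneg_of_neg_pi_div_two_le_of_le
      · have : 0 ≤ Real.pi / M s t := by positivity
        linarith [Real.pi_pos]
      · exact div_le_div_of_nonneg_left Real.pi_pos.le (by norm_num) hM2'
  generalize ρ.coroot s (ρ.root t) = f at *
  generalize ρ.coroot t (ρ.root s) = g at *
  by_cases hg : g = 0
  · have hf := h4 hg
    have hc' : c = 0 := by
      rw [hf, zero_mul] at hc
      nlinarith
    exact ⟨1, c, zero_le_one, by simp [hg, hc'], by simp [hf, hc'], hU⟩
  · have hf : f ≠ 0 := fun h => hg (h3 h)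
    have hc' : c ≠ 0 := by
      rintro rfl
      simp [hf, hg] at hc
    refine ⟨-g / (2 * c), c, by apply div_nonneg <;> linarith, ?_, ?_, hU⟩
    · field_simp
    · field_simp
      linarith

/-- Every `w` factors, with lengths adding up, as `v` times an alternating word in `s`, `t` ending
in `t`, where `v` has neither `s` nor `t` as a right descent. -/
theorem exists_alternatingWord_factorization {w : W} {s t : S}
    (ht : cs.IsRightDescent w t) :
    ∃ (v : W) (k : ℕ), 0 < k ∧ w = v * cs.wordProd (alternatingWord s t k) ∧
      cs.length w = cs.length v + k ∧ ¬ cs.IsRightDescent v s ∧ ¬ cs.IsRightDescent v t := by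
  classical
  -- The largest k admitting a length-additive factorization is the one wanted.
  let P : ℕ → Prop := fun k => ∃ v : W, w = v * cs.wordProd (alternatingWord s t k) ∧
    cs.length w = cs.length v + k
  have hP1 : P 1 := by
    refine ⟨w * cs.simple t, by simp [alternatingWord], ?_⟩
    have := cs.isRightDescent_iff.mp ht
    omega
  have hbound : 1 ≤ cs.length w := by
    obtain ⟨v, -, h⟩ := hP1
    omega
  obtain ⟨v, hw, hl⟩ : P (Nat.findGreatest P (cs.length w)) :=
    Nat.findGreatest_spec hbound hP1
  have hk : 1 ≤ Nat.findGreatest P (cs.length w) := Nat.le_findGreatest hbound hP1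
  have hmax : ¬ P (Nat.findGreatest P (cs.length w) + 1) := by
    rintro ⟨v', hv', hl'⟩
    have := Nat.le_findGreatest (P := P) (n := cs.length w) (by omega) ⟨v', hv', hl'⟩
    omega
  generalize Nat.findGreatest P (cs.length w) = k at *
  obtain ⟨j, rfl⟩ : ∃ j, k = j + 1 := ⟨k - 1, by omega⟩
  -- A descent at the first letter of the word would cancel it and make w too short.
  have hfirst : ¬ cs.IsRightDescent v (if Even j then t else s) := by
    intro h
    rw [alternatingWord_succ', wordProd_cons, ← mul_assoc] at hw
    have h1 := cs.length_mul_le (v * cs.simple (if Even j then t else s))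
      (cs.wordProd (alternatingWord s t j))
    rw [← hw] at h1
    have h2 := cs.length_wordProd_le (alternatingWord s t j)
    rw [length_alternatingWord] at h2
    have h3 := cs.isRightDescent_iff.mp h
    omega
  -- A descent at the other letter could be moved into the word, against maximality of k.
  have hother : ¬ cs.IsRightDescent v (if Even (j + 1) then t else s) := by
    intro h
    refine hmax ⟨v * cs.simple (if Even (j + 1) then t else s), ?_, ?_⟩
    · rw [alternatingWord_succ' s t (j + 1), wordProd_cons, mul_assoc,
        simple_mul_simple_cancel_left, hw]
    · have := cs.isRightDescent_iff.mp h
      omega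
  refine ⟨v, j + 1, by omega, hw, hl, ?_⟩
  by_cases hj : Even j
  · have hj' : ¬ Even (j + 1) := by simp [hj, parity_simps]
    rw [if_pos hj] at hfirst
    rw [if_neg hj'] at hother
    exact ⟨hother, hfirst⟩
  · have hj' : Even (j + 1) := by simp [hj, parity_simps]
    rw [if_neg hj] at hfirst
    rw [if_pos hj'] at hother
    exact ⟨hfirst, hother⟩

theorem act_root_mem_cone {w : W} {s : S} (hs : ¬ cs.IsRightDescent w s) :
    ρ.act w (ρ.root s) ∈ ρ.cone := by
  induction hn : cs.length w using Nat.strong_induction_on generalizing w s with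
  | _ n ih =>
  subst hn
  by_cases hw : w = 1
  · subst hw
    simpa using ρ.root_mem_cone s
  obtain ⟨t, ht⟩ := cs.exists_rightDescent_of_ne_one hw
  have hst : s ≠ t := by
    rintro rfl
    exact hs ht
  obtain ⟨v, k, hk, hwv, hl, hvs, hvt⟩ := exists_alternatingWord_factorization (s := s) ht
  -- Since w r_s is longer than w, appending s leaves the alternating word reduced, so its length k
  -- + 1 is at most m.
  have hkM : M s t ≠ 0 → k + 1 ≤ M s t := by
    intro hM
    by_contra hlt
    rw [M.symmetric s t] at hM hlt
    apply cs.not_isReduced_alternatingWord t s hM (m := k + 1) (by omega)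
    have h1 := cs.length_wordProd_le (alternatingWord t s (k + 1))
    rw [length_alternatingWord] at h1
    have h2 := cs.length_mul_le v (cs.wordProd (alternatingWord t s (k + 1)))
    have h3 : v * cs.wordProd (alternatingWord t s (k + 1)) = w * cs.simple s := by
      rw [alternatingWord_succ, wordProd_concat, hwv, mul_assoc]
    rw [h3, cs.not_isRightDescent_iff.mp hs] at h2
    rw [IsReduced, length_alternatingWord]
    omega
  obtain ⟨a, c, ha, h1, h2, hU⟩ := ρ.exists_scaling hst
  have hs' := ih (cs.length v) (by omega) hvs rfl
  have ht' := ih (cs.length v) (by omega) hvt rfl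
  -- The coefficients are U_{k-1}(c) and U_k(c), whence the need for k + 1 ≤ m and not just k ≤ m.
  have hUk := hU k (fun h => by have := hkM h; omega)
  have hUk' := hU (k + 1) hkM
  rw [Nat.cast_add_one, add_sub_cancel_right] at hUk'
  rw [hwv, act_mul_apply, ρ.act_alternatingWord_root h1 h2]
  split_ifs
  all_goals
    rw [map_add, map_smul, map_smul]
    apply add_mem <;> apply smul_mem_span_nnreal <;> first | assumption | positivity

theorem neg_act_root_mem_cone {w : W} {s : S} (hs : cs.IsRightDescent w s) :
    -ρ.act w (ρ.root s) ∈ ρ.cone := by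
  rw [← act_mul_simple_root]
  exact ρ.act_root_mem_cone (cs.isRightDescent_iff_not_isRightDescent_mul.mp hs)

/-! ### Recognizing the identity from its effect on simple roots. -/

theorem act_root_mem_cone_or (w : W) (s : S) :
    ρ.act w (ρ.root s) ∈ ρ.cone ∨ -ρ.act w (ρ.root s) ∈ ρ.cone := by
  by_cases h : cs.IsRightDescent w s
  exacts [Or.inr (ρ.neg_act_root_mem_cone h), Or.inl (ρ.act_root_mem_cone h)]

/-- A nontrivial w has a right descent s, and then -w α_s lies in the cone too, against pointedness.
-/
theorem eq_one_of_act_root_mem_cone {w : W} (h : ∀ s, ρ.act w (ρ.root s) ∈ ρ.cone) : w = 1 := by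
  by_contra hw
  obtain ⟨s, hs⟩ := cs.exists_rightDescent_of_ne_one hw
  exact ρ.act_root_ne_zero w s (ρ.eq_zero_of_mem_cone (h s) (ρ.neg_act_root_mem_cone hs))

/-- If k < 0, either sign of g α_r writes a simple root or a positive multiple of one as a sum of
two cone elements. Extremality then makes α_r a nonnegative multiple of α_t, which is excluded for r
≠ t. -/
theorem nonneg_of_act_root_eq {g : W} {r t : S} (hrt : r ≠ t) {k : ℝ}
    (h : ρ.act g (ρ.root r) = ρ.root r + k • ρ.root t) : 0 ≤ k := by
  by_contra! hk
  have hne {p : ℝ} (hp : ρ.root r = p • ρ.root t) (hp0 : 0 ≤ p) : False := by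
    refine ρ.root_notMem r (mem_PLC_of_mem_span ?_ (ρ.root_ne_zero r))
    rw [hp]
    refine smul_mem_span_nnreal hp0 (Submodule.subset_span ⟨⟨t, rfl⟩, fun h => hrt ?_⟩)
    exact ρ.root_injective (h.trans hp.symm).symm
  rcases ρ.act_root_mem_cone_or g r with hpos | hneg
  · obtain ⟨p, hp0, hp⟩ := ρ.exists_smul_root (t := r) (k := 1)
      (smul_mem_span_nnreal (neg_nonneg.mpr hk.le) (ρ.root_mem_cone t)) hpos
      (by rw [h]; module)
    have hp' : p ≠ 0 := by
      rintro rfl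
      rw [zero_smul, smul_eq_zero] at hp
      exact hp.elim (fun h => by linarith) (ρ.root_ne_zero t)
    refine hne (p := p⁻¹ * -k) ?_ (mul_nonneg (inv_nonneg.mpr hp0) (by linarith))
    rw [mul_smul, hp, inv_smul_smul₀ hp']
  · obtain ⟨p, hp0, hp⟩ := ρ.exists_smul_root (t := t) (k := -k) (ρ.root_mem_cone r) hneg
      (by rw [h]; module)
    exact hne hp hp0

/-- An element acting as a transvection along a simple root is trivial. -/
theorem eq_one_of_act_eq_add_smul {g : W} {t : S} (f : V →ₗ[ℝ] ℝ) (hf : f (ρ.root t) = 0)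
    (hg : ∀ x, ρ.act g x = x + f x • ρ.root t) : g = 1 := by
  have hg' : ∀ x, ρ.act g⁻¹ x = x + (-f x) • ρ.root t := by
    intro x
    apply (ρ.act g).injective
    rw [← act_mul_apply, mul_inv_cancel, hg, map_add, map_smul, hf]
    simp
  apply ρ.eq_one_of_act_root_mem_cone
  intro r
  by_cases hrt : r = t
  · rw [hrt, hg, hf, zero_smul, add_zero]
    exact ρ.root_mem_cone t
  · have h1 := ρ.nonneg_of_act_root_eq hrt (hg _)
    rw [hg]
    exact add_mem (ρ.root_mem_cone r) (smul_mem_span_nnreal h1 (ρ.root_mem_cone t))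

/-! ### Reflections in arbitrary roots. -/

theorem act_conj_simple (u : W) (s : S) (x : V) :
    ρ.act (u * cs.simple s * u⁻¹) x = x - ρ.coroot s (ρ.act u⁻¹ x) • ρ.act u (ρ.root s) := by
  rw [act_mul_apply, act_mul_apply, ρ.act_simple, map_sub, map_smul, ← act_mul_apply,
    mul_inv_cancel, map_one]
  rfl

/-- The reflection of a root that is proportional to a simple root is simple. -/
theorem conj_simple_eq {u : W} {s t : S} {p : ℝ}
    (h : ρ.act u (ρ.root s) = p • ρ.root t) : u * cs.simple s * u⁻¹ = cs.simple t := by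
  have hp : p ≠ 0 := by
    rintro rfl
    exact ρ.act_root_ne_zero u s (by rw [h, zero_smul])
  have ht : ρ.coroot s (ρ.act u⁻¹ (ρ.root t)) * p = 2 := by
    have : ρ.act u⁻¹ (p • ρ.root t) = ρ.root s := by
      rw [← h, ← act_mul_apply, inv_mul_cancel, map_one]
      rfl
    rw [← ρ.coroot_self s, ← this]
    simp [mul_comm]
  rw [← mul_inv_eq_one, cs.inv_simple]
  -- Both reflections negate α_t, so their product is a transvection along α_t; its functional is
  -- the difference of the two coroots, each taking the value 2 at α_t.
  apply ρ.eq_one_of_act_eq_add_smul (t := t)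
    (ρ.coroot t - p • (ρ.coroot s ∘ₗ (ρ.act u⁻¹).toLinearMap))
  · change ρ.coroot t (ρ.root t) - p * ρ.coroot s (ρ.act u⁻¹ (ρ.root t)) = 0
    rw [ρ.coroot_self]
    linarith
  · intro x
    change _ = x + (ρ.coroot t x - p * ρ.coroot s (ρ.act u⁻¹ x)) • ρ.root t
    rw [act_mul_apply, act_conj_simple, h, ρ.act_simple, map_sub, map_smul, map_sub, map_smul,
      smul_eq_mul]
    generalize ρ.coroot s (ρ.act u⁻¹ (ρ.root t)) = q at ht
    rw [eq_div_of_mul_eq hp ht]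
    match_scalars <;> field_simp
    ring

theorem act_reflection_mem_cone {w u : W} {s : S} (hu : ρ.act u (ρ.root s) ∈ ρ.cone)
    (hw : cs.length w < cs.length (w * (u * cs.simple s * u⁻¹))) :
    ρ.act w (ρ.act u (ρ.root s)) ∈ ρ.cone := by
  induction hn : cs.length w generalizing w with
  | zero =>
    rw [cs.length_eq_zero_iff.mp hn, map_one]
    exact hu
  | succ n ih =>
    obtain ⟨t, ht⟩ := cs.exists_leftDescent_of_ne_one (w := w) (by rintro rfl; simp at hn)
    have hl := cs.isLeftDescent_iff.mp ht
    set r := u * cs.simple s * u⁻¹ with hr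
    have h1 := cs.length_simple_mul (w * r) t
    -- Multiplying w r by r_t changes its length by one, so r_t w r is still longer than r_t w.
    have hpos := ih (w := cs.simple t * w) (by rw [mul_assoc]; omega) (by omega)
    have hw' : w = cs.simple t * (cs.simple t * w) := by simp
    generalize cs.simple t * w = v at *
    rw [← act_mul_apply]
    refine (ρ.act_root_mem_cone_or (w * u) s).resolve_right fun hneg => ?_
    rw [act_mul_apply, hw', act_mul_apply, ρ.act_simple] at hneg
    -- The cone elements v x and -r_t v x add up to a multiple of α_t, so extremality applies.
    obtain ⟨p, -, hp⟩ := ρ.exists_smul_root (t := t)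
      (k := ρ.coroot t (ρ.act v (ρ.act u (ρ.root s)))) hpos hneg (by module)
    rw [← act_mul_apply] at hp
    have hconj := ρ.conj_simple_eq hp
    have : w * r = v := by
      rw [hw', ← hconj, hr]
      simp [mul_assoc]
    rw [this] at hw
    omega

/-- The reflection r negates its root x, so the previous case for w r gives w r x = -w x in the
cone. -/
theorem neg_act_reflection_mem_cone {w u : W} {s : S} (hu : ρ.act u (ρ.root s) ∈ ρ.cone)
    (hw : cs.length (w * (u * cs.simple s * u⁻¹)) < cs.length w) :
    -ρ.act w (ρ.act u (ρ.root s)) ∈ ρ.cone := by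
  have e : w * (u * cs.simple s * u⁻¹) * (u * cs.simple s * u⁻¹) = w := by simp [mul_assoc]
  have h := ρ.act_reflection_mem_cone hu (hw.trans_eq (congrArg cs.length e.symm))
  rwa [← act_mul_apply, ← mul_assoc, ← mul_assoc, inv_mul_cancel_right, act_mul_simple_root,
    act_mul_apply] at h

end CoxeterSystem.RootRep

/-! ### The two representations attached to a datum. -/

namespace CoxeterDatum

variable {S V₁ V₂ W : Type*} [AddCommGroup V₁] [Module ℝ V₁] [AddCommGroup V₂] [Module ℝ V₂]
  (D : CoxeterDatum S V₁ V₂) [Group W] (cs : CoxeterSystem D.coxeterMatrix W)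

theorem one_le_of_order_eq_zero {s t : S} (hst : s ≠ t) (h : D.order s t = 0) :
    1 ≤ D.pairing (D.α s) (D.β t) * D.pairing (D.α t) (D.β s) := by
  refine (D.D5 s t).resolve_left fun hm => ?_
  rw [order, if_neg hst, dif_pos hm] at h
  have := (Nat.find_spec hm).1
  omega

theorem action₁_simple (s : S) : D.action₁ cs (cs.simple s) = D.ρ₁ s :=
  cs.lift_apply_simple D.isLiftable₁ s

theorem action₂_simple (s : S) : D.action₂ cs (cs.simple s) = D.ρ₂ s :=
  cs.lift_apply_simple D.isLiftable₂ s

/-- The representation of the Coxeter group on `V₁`. -/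
noncomputable def rootRep₁ : cs.RootRep V₁ where
  act := D.action₁ cs
  root := D.α
  coroot s := (2 : ℝ) • D.pairing.flip (D.β s)
  act_simple s x := by simp [action₁_simple, ρ₁_apply]
  coroot_self s := by simp [D.D1]
  coroot_nonpos s t h := by
    have := (D.D3 s t h).2
    simp only [LinearMap.smul_apply, LinearMap.flip_apply, smul_eq_mul]
    linarith
  coroot_eq_zero s t h := by
    have := D.D4 s t
    simp_all
  coroot_mul_of_ne_zero s t hst h := by
    have : _ = Real.cos (Real.pi / D.coxeterMatrix s t) ^ 2 := (D.order_spec hst h).2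
    rw [← this]
    simp only [LinearMap.smul_apply, LinearMap.flip_apply, smul_eq_mul]
    ring
  coroot_mul_of_eq_zero s t hst h := by
    have := D.one_le_of_order_eq_zero hst h
    simp only [LinearMap.smul_apply, LinearMap.flip_apply, smul_eq_mul]
    linarith
  root_injective := D.α_injective
  zero_notMem := D.D2_i₁
  root_notMem := D.D2_ii₁

/-- The representation of the Coxeter group on `V₂`. -/
noncomputable def rootRep₂ : cs.RootRep V₂ where
  act := D.action₂ cs
  root := D.β
  coroot s := (2 : ℝ) • D.pairing (D.α s)
  act_simple s x := by simp [action₂_simple, ρ₂_apply]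
  coroot_self s := by simp [D.D1]
  coroot_nonpos s t h := by
    have := (D.D3 s t h).1
    simp only [LinearMap.smul_apply, smul_eq_mul]
    linarith
  coroot_eq_zero s t h := by
    have := D.D4 s t
    simp_all
  coroot_mul_of_ne_zero s t hst h := by
    have : _ = Real.cos (Real.pi / D.coxeterMatrix s t) ^ 2 := (D.order_spec hst h).2
    rw [← this]
    simp only [LinearMap.smul_apply, smul_eq_mul]
    ring
  coroot_mul_of_eq_zero s t hst h := by
    have := D.one_le_of_order_eq_zero hst h
    simp only [LinearMap.smul_apply, smul_eq_mul]
    linarith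
  root_injective := D.β_injective
  zero_notMem := D.D2_i₂
  root_notMem := D.D2_ii₂

theorem action₁_mem_closure (w : W) :
    D.action₁ cs w ∈ Subgroup.closure (Set.range D.ρ₁) := by
  induction w using cs.simple_induction with
  | simple s =>
    rw [action₁_simple]
    exact Subgroup.subset_closure ⟨s, rfl⟩
  | one => rw [map_one]; exact one_mem _
  | mul u v hu hv => rw [map_mul]; exact mul_mem hu hv

theorem action₂_mem_closure (w : W) :
    D.action₂ cs w ∈ Subgroup.closure (Set.range D.ρ₂) := by
  induction w using cs.simple_induction with
  | simple s =>
    rw [action₂_simple]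
    exact Subgroup.subset_closure ⟨s, rfl⟩
  | one => rw [map_one]; exact one_mem _
  | mul u v hu hv => rw [map_mul]; exact mul_mem hu hv

theorem mem_posRoots₁ {w : W} {s : S}
    (h : D.action₁ cs w (D.α s) ∈ (D.rootRep₁ cs).cone) :
    D.action₁ cs w (D.α s) ∈ D.posRoots₁ :=
  ⟨⟨_, D.action₁_mem_closure cs w, s, rfl⟩,
    mem_PLC_of_mem_span h ((D.rootRep₁ cs).act_root_ne_zero w s)⟩

theorem mem_posRoots₂ {w : W} {s : S}
    (h : D.action₂ cs w (D.β s) ∈ (D.rootRep₂ cs).cone) :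
    D.action₂ cs w (D.β s) ∈ D.posRoots₂ :=
  ⟨⟨_, D.action₂_mem_closure cs w, s, rfl⟩,
    mem_PLC_of_mem_span h ((D.rootRep₂ cs).act_root_ne_zero w s)⟩

/-- The negative of a root is again a root, because -w α_s = (w r_s) α_s. -/
theorem mem_negRoots₁ {w : W} {s : S}
    (h : -D.action₁ cs w (D.α s) ∈ (D.rootRep₁ cs).cone) :
    D.action₁ cs w (D.α s) ∈ D.negRoots₁ := by
  have e : D.action₁ cs (w * cs.simple s) (D.α s) = -D.action₁ cs w (D.α s) :=
    (D.rootRep₁ cs).act_mul_simple_root w s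
  rw [← e] at h
  have h' := D.mem_posRoots₁ cs h
  rw [e] at h'
  exact h'

theorem mem_negRoots₂ {w : W} {s : S}
    (h : -D.action₂ cs w (D.β s) ∈ (D.rootRep₂ cs).cone) :
    D.action₂ cs w (D.β s) ∈ D.negRoots₂ := by
  have e : D.action₂ cs (w * cs.simple s) (D.β s) = -D.action₂ cs w (D.β s) :=
    (D.rootRep₂ cs).act_mul_simple_root w s
  rw [← e] at h
  have h' := D.mem_posRoots₂ cs h
  rw [e] at h'
  exact h'

end CoxeterDatum

theorem proposition3 {S V₁ V₂ W : Type*} [AddCommGroup V₁] [Module ℝ V₁]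
    [AddCommGroup V₂] [Module ℝ V₂] (D : CoxeterDatum S V₁ V₂)
    [Group W] (cs : CoxeterSystem D.coxeterMatrix W) (w : W) :
    (∀ x ∈ D.posRoots₁, ∀ r : W, D.IsReflectionOf₁ cs r x →
      (cs.length w < cs.length (w * r) → D.action₁ cs w x ∈ D.posRoots₁) ∧
      (cs.length (w * r) < cs.length w → D.action₁ cs w x ∈ D.negRoots₁)) ∧
    (∀ y ∈ D.posRoots₂, ∀ r : W, D.IsReflectionOf₂ cs r y →
      (cs.length w < cs.length (w * r) → D.action₂ cs w y ∈ D.posRoots₂) ∧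
      (cs.length (w * r) < cs.length w → D.action₂ cs w y ∈ D.negRoots₂)) := by
  refine ⟨?_, ?_⟩
  · rintro _ ⟨-, hx⟩ _ ⟨u, s, rfl, rfl⟩
    have hx' := mem_span_of_mem_PLC hx
    have e : D.action₁ cs (w * u) (D.α s) = D.action₁ cs w (D.action₁ cs u (D.α s)) :=
      (D.rootRep₁ cs).act_mul_apply w u (D.α s)
    rw [← e]
    refine ⟨fun h => D.mem_posRoots₁ cs ?_, fun h => D.mem_negRoots₁ cs ?_⟩
    · have := (D.rootRep₁ cs).act_reflection_mem_cone hx' h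
      rwa [← (D.rootRep₁ cs).act_mul_apply] at this
    · have := (D.rootRep₁ cs).neg_act_reflection_mem_cone hx' h
      rwa [← (D.rootRep₁ cs).act_mul_apply] at this
  · rintro _ ⟨-, hx⟩ _ ⟨u, s, rfl, rfl⟩
    have hx' := mem_span_of_mem_PLC hx
    have e : D.action₂ cs (w * u) (D.β s) = D.action₂ cs w (D.action₂ cs u (D.β s)) :=
      (D.rootRep₂ cs).act_mul_apply w u (D.β s)
    rw [← e]
    refine ⟨fun h => D.mem_posRoots₂ cs ?_, fun h => D.mem_negRoots₂ cs ?_⟩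
    · have := (D.rootRep₂ cs).act_reflection_mem_cone hx' h
      rwa [← (D.rootRep₂ cs).act_mul_apply] at this
    · have := (D.rootRep₂ cs).neg_act_reflection_mem_cone hx' h
      rwa [← (D.rootRep₂ cs).act_mul_apply] at this
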